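/- **Theorem (permutation duality).** Let $n\ge 1$. For an element $x$ of a finite poset $P$ let $D(x)=\{y: y\prec x\}$ be its strict downset. If $P$ is (2+2)-free (no induced subposet is a disjoint union of two 2-element chains), the distinct strict downsets form a chain $\emptyset=D_0\subsetneq D_1\subsetneq\dots\subsetneq D_{\ell(P)}$; the elements $x$ with $D(x)=D_i$ are said to be at level $i$, and $L_i$ is the set of these elements. Let $\ell^\star(P)$ be the least level containing a maximal element. Let $\mathsf{RPosets}_n$ be the set of (unlabelled) (2+2)-free posets with $n$ elements that have a chain of length $\ell(P)$, i.e. a chain $x_0\prec x_1\prec\dots\prec x_{\ell(P)}$. *Posets to sequences.* For a nonempty (2+2)-free poset $P$ and $i=\ell^\star(P)$, let $\mathsf{remove}(P)$ be obtained as follows. If $|L_i|>1$, delete a maximal element at level $i$. If $|L_i|=1$ and $i=\ell(P)$, delete the unique element at level $i$. If $|L_i|=1$ and $i<\ell(P)$, delete all relations $x\prec y$ with $x\in D_{i+1}\setminus D_i$, and then delete the unique element that was at level $i$. With $P^{(n)}=P$ and $P^{(k)}=\mathsf{remove}(P^{(k+1)})$ for $1\le k<n$, put $f_{PA}(P)=(\ell^\star(P^{(1)}),\dots,\ell^\star(P^{(n)}))$.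 *Sequences to permutations.* In a permutation $\pi=\pi_1\cdots\pi_m$ the sites before $\pi_1$ and after $\pi_m$ are active, and the site between $\pi_j$ and $\pi_{j+1}$ is active if $\pi_j=1$ or $\pi_j-1$ is to the left of $\pi_j$. Active sites are labelled $0,1,2,\dots$ from left to right. For $\mathbf a=(a_1,\dots,a_n)$ in the image of $f_{PA}$, start with the permutation $1$ and, for $k=2,\dots,n$, insert $k$ at the active site labelled $a_k$; the result is $f_{AS}(\mathbf a)$. Put $f_{PS}=f_{AS}\circ f_{PA}$. *Permutations.* Let $\mathcal S_n(3\bar152\bar4)$ be the set of permutations $\pi$ of $\{1,\dots,n\}$ such that for all $i<j<k$ with $\pi_k<\pi_i<\pi_j$ there are $l,m$ with $i<l<j<k<m$ and $\pi_l<\pi_k<\pi_i<\pi_m<\pi_j$. Let $\mathrm{rev}(\pi)=(\pi_n,\dots,\pi_1)$ and $\mathrm c(\pi)=(n+1-\pi_1,\dots,n+1-\pi_n)$. Then every $\pi\in\mathcal S_n(3\bar152\bar4)$ has a dual according to $f_{PS}$: there is, up to isomorphism, exactly one $P\in\mathsf{RPosets}_n$ with $f_{PS}(P)=\pi$, and the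 order dual $P^*$ again lies in $\mathsf{RPosets}_n$. The dual permutation $\pi^*:=f_{PS}(P^*)$ is $$\pi^*=\bigl(\mathrm c(\mathrm{rev}(\pi))\bigr)^{-1},$$ the inverse of the complement of the reverse of $\pi$. -/

import Mathlib

/-! ### Finite posets: strict downsets and levels

The strict downset of `x` is `Set.Iio x`.  In a (2+2)-free poset the strict downsets form a chain
`∅ = D 0 ⊂ D 1 ⊂ ... ⊂ D ℓ`; the element `x` lies at level `i` when its strict downset is `D i`. -/

namespace PosetDuality

/-- `ℓ(P)`: the number of distinct nonempty strict downsets. -/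
noncomputable def ell (P : Type*) [PartialOrder P] : ℕ :=
  {D : Set P | D ∈ Set.range (Set.Iio : P → Set P) ∧ D.Nonempty}.ncard

/-- The level of `x`: the number of strict downsets strictly contained in that of `x`, i.e. the
index of `Set.Iio x` in the list of all strict downsets ordered by inclusion. -/
noncomputable def level {P : Type*} [PartialOrder P] (x : P) : ℕ :=
  {D : Set P | D ∈ Set.range (Set.Iio : P → Set P) ∧ D ⊂ Set.Iio x}.ncard

/-- The set `L i` of elements at level `i`. -/
def levelSet (P : Type*) [PartialOrder P] (i : ℕ) : Set P :=
  {x | level x = i}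

/-- The common strict downset `D i` of the elements at level `i`. -/
def levelDownset (P : Type*) [PartialOrder P] (i : ℕ) : Set P :=
  {y | ∃ x ∈ levelSet P i, y < x}

/-- `ℓ⋆(P)`: the least level that contains a maximal element. -/
noncomputable def ellStar (P : Type*) [PartialOrder P] : ℕ :=
  sInf {i | ∃ x : P, IsMax x ∧ level x = i}

/-- No induced subposet is a disjoint union of two 2-element chains. (The order on a sum type is
the one in which elements of different summands are incomparable.) -/
def IsTwoPlusTwoFree (P : Type*) [PartialOrder P] : Prop :=
  IsEmpty (Fin 2 ⊕ Fin 2 ↪o P)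

/-- The (2+2)-free posets with `n` elements that have a chain of length `ℓ(P)`, the length of
a chain being its number of strict steps. -/
def IsRPoset (n : ℕ) (P : FinPartOrd.{0}) : Prop :=
  Fintype.card P = n ∧ IsTwoPlusTwoFree P ∧ ∃ s : LTSeries P, s.length = ell P

/-! ### From posets to ascent sequences -/

/-- The order on `P` with all relations `x < y`, `x ∈ M`, deleted. -/
@[reducible] def cutOrder (P : Type*) [PartialOrder P] (M : Set P) : PartialOrder P where
  le x y := x = y ∨ (x < y ∧ x ∉ M)
  lt x y := x < y ∧ x ∉ M
  le_refl x := Or.inl rfl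
  le_trans x y z := by
    rintro (rfl | ⟨h, hM⟩) (rfl | ⟨h', hM'⟩)
    · exact Or.inl rfl
    · exact Or.inr ⟨h', hM'⟩
    · exact Or.inr ⟨h, hM⟩
    · exact Or.inr ⟨h.trans h', hM⟩
  lt_iff_le_not_ge x y := by
    constructor
    · rintro ⟨h, hM⟩
      refine ⟨Or.inr ⟨h, hM⟩, ?_⟩
      rintro (rfl | ⟨h', -⟩)
      · exact lt_irrefl _ h
      · exact lt_asymm h h'
    · rintro ⟨rfl | h, h'⟩
      · exact absurd (Or.inl rfl) h'
      · exact h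
  le_antisymm x y := by
    rintro (rfl | ⟨h, -⟩) (h' | ⟨h', -⟩)
    · rfl
    · rfl
    · exact h'.symm
    · exact absurd h' (lt_asymm h)

open Classical in
/-- `P` with the element `x` deleted. -/
noncomputable def eraseElt (P : Type) [PartialOrder P] [Fintype P] (x : P) : FinPartOrd.{0} :=
  FinPartOrd.of {y : P // y ≠ x}

open Classical in
/-- The three cases of the reduction step; `x` is a maximal element at level `i = ℓ⋆(P)`. If `x`
is not alone at its level, or if its level is the last one, then `x` is just deleted. Otherwise
the elements of `D (i+1) \ D i` are first made maximal. -/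
noncomputable def removeElt (P : FinPartOrd.{0}) (x : P) : FinPartOrd.{0} :=
  if 1 < (levelSet P (ellStar P)).ncard then
    eraseElt P x
  else if ellStar P = ell P then
    eraseElt P x
  else
    @eraseElt P (cutOrder P (levelDownset P (ellStar P + 1) \ levelDownset P (ellStar P))) _ x

open Classical in
/-- The reduction step: remove a maximal element at level `ℓ⋆(P)`. Such an element exists in
every nonempty finite poset; the empty poset is left unchanged. -/
noncomputable def remove (P : FinPartOrd.{0}) : FinPartOrd.{0} :=
  if h : ∃ x : P, IsMax x ∧ level x = ellStar P then removeElt P h.choose else P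

/-- `(a₁, ..., aₖ)`, where `aₖ = ℓ⋆(P)` and `(a₁, ..., aₖ₋₁)` is obtained in the same way from
the reduced poset. -/
noncomputable def ascSeq : ℕ → FinPartOrd.{0} → List ℕ
  | 0, _ => []
  | k + 1, P => ascSeq k (remove P) ++ [ellStar P]

/-- The map from (2+2)-free posets to ascent sequences. -/
noncomputable def fPA (P : FinPartOrd.{0}) : List ℕ :=
  ascSeq (Fintype.card P) P

/-! ### From ascent sequences to permutations in one-line notation -/

/-- The active sites of the permutation `w = w₁ ... wₘ` from left to right; `j` is the site with
exactly `j` entries before it. The first and the last site are active, and the site after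
`wⱼ`, `0 < j < m`, is active when `wⱼ = 1` or `wⱼ - 1` is to the left of `wⱼ`. -/
def activeSites (w : List ℕ) : List ℕ :=
  (List.range (w.length + 1)).filter fun j =>
    j = 0 ∨ j = w.length ∨ w.getD (j - 1) 0 = 1 ∨ w.getD (j - 1) 0 - 1 ∈ w.take (j - 1)

/-- Insert the next entry at the active site labelled `k`, the labels starting at `0`. -/
def insertNext (w : List ℕ) (k : ℕ) : List ℕ :=
  w.insertIdx ((activeSites w).getD k 0) (w.length + 1)

/-- The map from ascent sequences to permutations. -/
def fAS (a : List ℕ) : List ℕ :=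
  a.foldl insertNext []

/-- `f_PS = f_AS ∘ f_PA`. -/
noncomputable def fPS (P : FinPartOrd.{0}) : List ℕ :=
  fAS (fPA P)

/-! ### Permutations -/

/-- One-line notation `π(1) ... π(n)` with entries in `{1, ..., n}`. -/
def oneLine {n : ℕ} (π : Equiv.Perm (Fin n)) : List ℕ :=
  List.ofFn fun i => (π i : ℕ) + 1

/-- The reverse `(π(n), ..., π(1))`. -/
def rev {n : ℕ} (π : Equiv.Perm (Fin n)) : Equiv.Perm (Fin n) :=
  Fin.revPerm.trans π

/-- The complement `(n + 1 - π(1), ..., n + 1 - π(n))`. -/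
def compl {n : ℕ} (π : Equiv.Perm (Fin n)) : Equiv.Perm (Fin n) :=
  π.trans Fin.revPerm

/-- Avoidance of the barred pattern `3 1̄ 5 2 4̄`: every occurrence of 231 plays the role of 352
in an occurrence of 31524. -/
def AvoidsBarred {n : ℕ} (π : Equiv.Perm (Fin n)) : Prop :=
  ∀ i j k : Fin n, i < j → j < k → π k < π i → π i < π j →
    ∃ l m : Fin n, i < l ∧ l < j ∧ k < m ∧ π l < π k ∧ π i < π m ∧ π m < π j

/-! ### Duality -/

/-- The dual of `s` according to `f` is defined, and it is `t`: up to isomorphism there is exactly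
one `n`-element poset `P` of the restricted class with `f P = s`, its order dual is again in the
class, and `f Pᵒᵈ = t`. -/
def IsDualAccordingTo {S : Type*} (n : ℕ) (f : FinPartOrd.{0} → S) (s t : S) : Prop :=
  (∃ P : FinPartOrd.{0}, IsRPoset n P ∧ f P = s) ∧
  (∀ P Q : FinPartOrd.{0}, IsRPoset n P → IsRPoset n Q → f P = s →
    (f Q = s ↔ Nonempty (P ≃o Q))) ∧
  (∀ P : FinPartOrd.{0}, IsRPoset n P → f P = s →
    IsRPoset n (FinPartOrd.of Pᵒᵈ) ∧ f (FinPartOrd.of Pᵒᵈ) = t)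

end PosetDuality

/-!
Represent `P` as the interval order of the intervals from the level of `x` to the largest `k` with
`x ∉ D k`. A chain of length `ℓ(P)` exists exactly when all one-point intervals `[k, k]` occur.
This excludes the third case of the reduction step: each step deletes an interval that is last by
increasing right endpoint and then decreasing left endpoint, and records its left endpoint. Hence
`f_PA` lists the left endpoints in this order, and the elements get their places in it as labels.

When a self-modified ascent sequence is read by `f_AS`, the active sites are the boundaries between
levels, so every label is inserted at the front of its level: `π` lists the labels by increasing
left endpoint and then decreasing label. Reversing all intervals therefore exchanges labels and
positions up to reflection, which is the reverse-complement-inverse of `π`.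

Conversely `π` determines the intervals. The label `v` of an interval `[k, k]` that comes first
among the labels with right endpoint `k` is recognised by `v - 1` standing to its left (or `v`
being minimal), and endpoints are numbers of such labels. For an arbitrary permutation, avoidance
of the barred pattern is what makes the intervals counted in this way represent it.
-/

namespace PosetDuality

/-! ### Interval representations -/

/-- `x ↦ [l x, r x]` is a family of intervals in `{0, ..., m - 1}` in which every one-point
interval occurs. -/
structure IntervalFamily {ι : Type*} (m : ℕ) (l r : ι → ℕ) : Prop where
  le : ∀ x, l x ≤ r x
  lt : ∀ x, r x < m
  diag : ∀ k < m, ∃ x, l x = k ∧ r x = k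

namespace IntervalFamily

variable {ι κ : Type*} {m : ℕ} {l r : ι → ℕ}

lemma comp_surjective (h : IntervalFamily m l r) {f : κ → ι} (hf : Function.Surjective f) :
    IntervalFamily m (l ∘ f) (r ∘ f) where
  le x := h.le (f x)
  lt x := h.lt (f x)
  diag k hk := by
    obtain ⟨y, hy⟩ := h.diag k hk
    obtain ⟨x, rfl⟩ := hf y
    exact ⟨x, hy⟩

lemma dual (h : IntervalFamily m l r) :
    IntervalFamily m (fun x => m - 1 - r x) (fun x => m - 1 - l x) where
  le x := Nat.sub_le_sub_left (h.le x) _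
  lt x := by have := h.lt x; omega
  diag k hk := by
    obtain ⟨x, hl, hr⟩ := h.diag (m - 1 - k) (by omega)
    exact ⟨x, by omega, by omega⟩

lemma dual_lt_dual_iff (h : IntervalFamily m l r) {x y : ι} :
    m - 1 - l x < m - 1 - r y ↔ r y < l x := by
  have := h.le x
  have := h.lt x
  omega

lemma downset_strictMonoOn (h : IntervalFamily m l r) :
    StrictMonoOn (fun k => {y | r y < k}) (Set.Iio m) := by
  intro j hj k _ hjk
  obtain ⟨x, -, hx⟩ := h.diag j hj
  exact (Set.ssubset_iff_of_subset fun y (hy : r y < j) => hy.trans hjk).2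
    ⟨x, hx.trans_lt hjk, hx.not_lt⟩

end IntervalFamily

/-- A representation of `P` as the interval order of the intervals `[l x, r x]`. -/
structure IntervalRep {P : Type*} [PartialOrder P] (m : ℕ) (l r : P → ℕ) : Prop extends
    IntervalFamily m l r where
  lt_iff : ∀ x y, x < y ↔ r x < l y

namespace IntervalRep

variable {P : Type*} [PartialOrder P] {m : ℕ} {l r : P → ℕ}

lemma Iio_eq (h : IntervalRep m l r) (x : P) : Set.Iio x = {y | r y < l x} :=
  Set.ext fun y => h.lt_iff y x

lemma range_Iio (h : IntervalRep m l r) :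
    Set.range (Set.Iio : P → Set P) = (fun k => {y | r y < k}) '' Set.Iio m := by
  ext D
  constructor
  · rintro ⟨x, rfl⟩
    exact ⟨l x, (h.le x).trans_lt (h.lt x), (h.Iio_eq x).symm⟩
  · rintro ⟨k, hk, rfl⟩
    obtain ⟨x, hx, -⟩ := h.diag k hk
    exact ⟨x, by rw [h.Iio_eq, hx]⟩

lemma level_eq (h : IntervalRep m l r) (x : P) : level x = l x := by
  have hx : l x < m := (h.le x).trans_lt (h.lt x)
  have hdownsets : {D | D ∈ Set.range (Set.Iio : P → Set P) ∧ D ⊂ Set.Iio x} =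
      (fun k => {y | r y < k}) '' Set.Iio (l x) := by
    ext D
    rw [Set.mem_ofPred_eq, h.range_Iio, h.Iio_eq]
    constructor
    · rintro ⟨⟨k, hk, rfl⟩, hD⟩
      exact ⟨k, (h.downset_strictMonoOn.lt_iff_lt hk hx).1 hD, rfl⟩
    · rintro ⟨k, hk, rfl⟩
      exact ⟨⟨k, hk.trans hx, rfl⟩, h.downset_strictMonoOn (hk.trans hx) hx hk⟩
  rw [level, hdownsets,
    (h.downset_strictMonoOn.injOn.mono (Set.Iio_subset_Iio hx.le)).ncard_image, Set.ncard_Iio_nat]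

lemma ell_eq (h : IntervalRep m l r) : ell P = m - 1 := by
  have hdownsets : {D | D ∈ Set.range (Set.Iio : P → Set P) ∧ D.Nonempty} =
      (fun k => {y | r y < k}) '' Set.Ico 1 m := by
    ext D
    rw [Set.mem_ofPred_eq, h.range_Iio]
    constructor
    · rintro ⟨⟨k, hk, rfl⟩, y, hy⟩
      exact ⟨k, ⟨Nat.one_le_of_lt hy, hk⟩, rfl⟩
    · rintro ⟨k, hk, rfl⟩
      obtain ⟨y, -, hy⟩ := h.diag 0 (by have := hk.1; have := hk.2; omega)
      exact ⟨⟨k, hk.2, rfl⟩, y, hy.trans_lt hk.1⟩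
  rw [ell, hdownsets,
    (h.downset_strictMonoOn.injOn.mono Set.Ico_subset_Iio_self).ncard_image, Set.ncard_Ico_nat]

lemma isMax_iff (h : IntervalRep m l r) (x : P) : IsMax x ↔ r x + 1 = m := by
  have hx := h.lt x
  rw [isMax_iff_forall_not_lt]
  constructor
  · intro hmax
    obtain ⟨y, hy, -⟩ := h.diag (m - 1) (by omega)
    have := mt (h.lt_iff x y).2 (hmax y)
    omega
  · intro hr y hxy
    have := (h.lt_iff x y).1 hxy
    have := h.le y
    have := h.lt y
    omega

lemma isTwoPlusTwoFree (h : IntervalRep m l r) : IsTwoPlusTwoFree P := by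
  refine ⟨fun f => ?_⟩
  have h₁ : f (.inl 0) < f (.inl 1) := f.lt_iff_lt.2 (by simp)
  have h₂ : f (.inr 0) < f (.inr 1) := f.lt_iff_lt.2 (by simp)
  have h₁₂ : ¬ f (.inl 0) < f (.inr 1) := fun hlt => by simpa using f.lt_iff_lt.1 hlt
  have h₂₁ : ¬ f (.inr 0) < f (.inl 1) := fun hlt => by simpa using f.lt_iff_lt.1 hlt
  rw [h.lt_iff] at h₁ h₂ h₁₂ h₂₁
  omega

lemma exists_ltSeries [Nonempty P] (h : IntervalRep m l r) :
    ∃ s : LTSeries P, s.length = ell P := by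
  have hm : 0 < m := Nat.zero_lt_of_lt (h.lt (Classical.arbitrary P))
  choose d hl hr using h.diag
  rw [h.ell_eq]
  refine ⟨⟨m - 1, fun i => d i (by omega), fun i => (h.lt_iff _ _).2 ?_⟩, rfl⟩
  rw [hl, hr]
  exact i.castSucc_lt_succ

end IntervalRep

namespace IsTwoPlusTwoFree

variable {P : Type*} [PartialOrder P]

lemma Iio_total (h : IsTwoPlusTwoFree P) (x y : P) :
    Set.Iio x ⊆ Set.Iio y ∨ Set.Iio y ⊆ Set.Iio x := by
  by_contra hcon
  simp only [not_or, Set.not_subset, Set.mem_Iio] at hcon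
  obtain ⟨⟨a, hax, hay⟩, b, hby, hbx⟩ := hcon
  have hab : ¬ a ≤ b := fun h => hay (h.trans_lt hby)
  have hba : ¬ b ≤ a := fun h => hbx (h.trans_lt hax)
  have hay' : ¬ a ≤ y := fun h => h.eq_or_lt.elim (fun h => hba (h ▸ hby.le)) hay
  have hbx' : ¬ b ≤ x := fun h => h.eq_or_lt.elim (fun h => hab (h ▸ hax.le)) hbx
  have hxb : ¬ x ≤ b := fun h => hab (hax.le.trans h)
  have hya : ¬ y ≤ a := fun h => hba (hby.le.trans h)
  have hxy : ¬ x ≤ y := fun h => hay (hax.trans_le h)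
  have hyx : ¬ y ≤ x := fun h => hbx (hby.trans_le h)
  refine h.false (OrderEmbedding.ofMapLEIff (Sum.elim ![a, x] ![b, y]) ?_)
  rintro (i | i) (j | j) <;> fin_cases i <;> fin_cases j <;>
    simp [hax.le, hby.le, hax.not_ge, hby.not_ge, *]

end IsTwoPlusTwoFree

/-- The largest `k` such that `x` does not lie in the `k`-th strict downset: the right endpoint of
`x` in the representation whose left endpoints are the levels. -/
noncomputable def lastLevel {P : Type*} [PartialOrder P] (x : P) : ℕ :=
  {D : Set P | D ∈ Set.range (Set.Iio : P → Set P) ∧ x ∉ D}.ncard - 1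

section LastLevel

variable {P : Type*} [PartialOrder P] [Finite P]

lemma lastLevel_add_one (x : P) :
    lastLevel x + 1 = {D : Set P | D ∈ Set.range (Set.Iio : P → Set P) ∧ x ∉ D}.ncard :=
  Nat.sub_add_cancel ((Set.ncard_pos).2 ⟨Set.Iio x, ⟨x, rfl⟩, lt_irrefl x⟩)

lemma lastLevel_le_ell (x : P) : lastLevel x ≤ ell P := by
  have hsub : {D : Set P | D ∈ Set.range (Set.Iio : P → Set P) ∧ x ∉ D} ⊆
      insert ∅ {D : Set P | D ∈ Set.range (Set.Iio : P → Set P) ∧ D.Nonempty} := fun D hD =>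
    D.eq_empty_or_nonempty.imp_right fun hne => ⟨hD.1, hne⟩
  rw [← Nat.add_le_add_iff_right (n := 1), lastLevel_add_one]
  exact (Set.ncard_le_ncard hsub).trans (Set.ncard_insert_le _ _)

namespace IsTwoPlusTwoFree

lemma lt_iff_lastLevel_lt_level (h : IsTwoPlusTwoFree P) {x y : P} :
    x < y ↔ lastLevel x < level y := by
  rw [← Nat.add_one_le_iff, lastLevel_add_one]
  constructor
  · refine fun hxy => Set.ncard_le_ncard ?_
    rintro D ⟨⟨z, rfl⟩, hxz⟩
    have hnot : ¬ Set.Iio y ⊆ Set.Iio z := fun hyz => hxz (hyz hxy)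
    exact ⟨⟨z, rfl⟩, (h.Iio_total z y).resolve_right hnot, hnot⟩
  · contrapose!
    intro hxy
    refine Set.ncard_lt_ncard ((Set.ssubset_iff_of_subset ?_).2
      ⟨Set.Iio y, ⟨⟨y, rfl⟩, hxy⟩, fun hy => ssubset_irrefl _ hy.2⟩)
    exact fun D hD => ⟨hD.1, fun hxD => hxy (hD.2.1 hxD)⟩

lemma level_le_lastLevel (h : IsTwoPlusTwoFree P) (x : P) : level x ≤ lastLevel x :=
  not_lt.1 fun hx => lt_irrefl x (h.lt_iff_lastLevel_lt_level.2 hx)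

lemma level_strictMono (h : IsTwoPlusTwoFree P) : StrictMono (level : P → ℕ) := fun x _ hxy =>
  (h.level_le_lastLevel x).trans_lt (h.lt_iff_lastLevel_lt_level.1 hxy)

lemma lastLevel_strictMono (h : IsTwoPlusTwoFree P) : StrictMono (lastLevel : P → ℕ) :=
  fun _ y hxy => (h.lt_iff_lastLevel_lt_level.1 hxy).trans_le (h.level_le_lastLevel y)

lemma intervalRep (h : IsTwoPlusTwoFree P) (s : LTSeries P) (hs : s.length = ell P) :
    IntervalRep (ell P + 1) (level : P → ℕ) lastLevel where
  le := h.level_le_lastLevel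
  lt x := Nat.lt_succ_of_le (lastLevel_le_ell x)
  lt_iff _ _ := h.lt_iff_lastLevel_lt_level
  diag k hk := by
    let i : Fin (s.length + 1) := ⟨k, hs ▸ hk⟩
    have hlow : level (s 0) + k ≤ level (s i) + 0 :=
      (s.map level h.level_strictMono).apply_add_index_le_apply_add_index_nat 0 i (Fin.zero_le i)
    have hup : lastLevel (s i) + s.length ≤ lastLevel (s (Fin.last _)) + k :=
      (s.map lastLevel h.lastLevel_strictMono).apply_add_index_le_apply_add_index_nat
        i (Fin.last _) (Fin.le_last i)
    have hle := h.level_le_lastLevel (s i)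
    have hlast := lastLevel_le_ell (s (Fin.last _))
    exact ⟨s i, by omega, by omega⟩

end IsTwoPlusTwoFree

end LastLevel

/-! ### The ascent sequence of an interval order -/

lemma map_univ_val_eq_cons {α β : Type*} [Fintype α] (x : α) [Fintype {y // y ≠ x}] (f : α → β) :
    (Finset.univ : Finset α).val.map f =
      f x ::ₘ (Finset.univ : Finset {y // y ≠ x}).val.map fun y : {y // y ≠ x} => f y := by
  classical
  have hrest := Finset.univ_val_map_subtype_restrict f (· ≠ x)
  rw [Subtype.restrict_def, Function.comp_def] at hrest
  rw [hrest, Finset.filter_ne', ← Multiset.map_cons, Finset.erase_val,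
    Multiset.cons_erase (Finset.mem_univ_val x)]

/-- Comparison of the intervals `[p.1, p.2]` and `[q.1, q.2]` by increasing right endpoint and, for
equal right endpoints, by decreasing left endpoint. -/
def RightOrder (p q : ℕ × ℕ) : Prop :=
  p.2 < q.2 ∨ p.2 = q.2 ∧ q.1 ≤ p.1

lemma RightOrder.antisymm {p q : ℕ × ℕ} (hpq : RightOrder p q) (hqp : RightOrder q p) : p = q := by
  unfold RightOrder at hpq hqp
  ext <;> omega

lemma exists_isMax_level_eq_ellStar (P : Type*) [PartialOrder P] [Finite P] [Nonempty P] :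
    ∃ x : P, IsMax x ∧ level x = ellStar P := by
  obtain ⟨x, hx⟩ := (Set.finite_univ (α := P)).exists_maximal Set.univ_nonempty
  have hmax : IsMax x := fun y hxy => hx.2 (Set.mem_univ y) hxy
  exact Nat.sInf_mem (s := {i | ∃ x : P, IsMax x ∧ level x = i}) ⟨level x, x, hmax, rfl⟩

lemma IntervalFamily.erase {ι : Type*} {m : ℕ} {l r : ι → ℕ} (h : IntervalFamily m l r) {x : ι}
    (hx : ∀ y, RightOrder (l y, r y) (l x, r x)) :
    ∃ m', IntervalFamily m' (fun y : {y // y ≠ x} => l y) (fun y => r y) := by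
  unfold RightOrder at hx
  have hm : 0 < m := Nat.zero_lt_of_lt (h.lt x)
  obtain ⟨z, hlz, hrz⟩ := h.diag (m - 1) (by omega)
  have hrx : r x < m := h.lt x
  have hzx := hx z
  by_cases hlast : ∃ y, y ≠ x ∧ l y = m - 1 ∧ r y = m - 1
  · obtain ⟨z', hz'x, hz'⟩ := hlast
    refine ⟨m, fun y => h.le y, fun y => h.lt y, fun k hk => ?_⟩
    obtain ⟨y, hly, hry⟩ := h.diag k hk
    rcases eq_or_ne y x with rfl | hyx
    · exact ⟨⟨z', hz'x⟩, by dsimp only at *; omega⟩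
    · exact ⟨⟨y, hyx⟩, hly, hry⟩
  · push Not at hlast
    obtain rfl : z = x := by_contra fun hne => hlast z hne hlz hrz
    refine ⟨m - 1, fun y => h.le y, fun y => ?_, fun k hk => ?_⟩
    · have hly := h.le y
      have hyz := hx y
      have hy := hlast y y.2
      dsimp only at *
      omega
    · obtain ⟨y, hly, hry⟩ := h.diag k (by omega)
      exact ⟨⟨y, by rintro rfl; omega⟩, hly, hry⟩

namespace IntervalRep

lemma erase {P : Type*} [PartialOrder P] {m : ℕ} {l r : P → ℕ} (h : IntervalRep m l r) {x : P}
    (hx : ∀ y, RightOrder (l y, r y) (l x, r x)) :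
    ∃ m', IntervalRep m' (fun y : {y // y ≠ x} => l y) (fun y => r y) := by
  obtain ⟨m', h'⟩ := h.toIntervalFamily.erase hx
  exact ⟨m', h', fun y z => h.lt_iff y z⟩

variable {P : FinPartOrd.{0}} {m : ℕ} {l r : P → ℕ}

lemma rightOrder_of_level_eq_ellStar (h : IntervalRep m l r) {x : P} (hx : IsMax x)
    (hlx : level x = ellStar P) (y : P) : RightOrder (l y, r y) (l x, r x) := by
  rw [h.isMax_iff] at hx
  rcases (Nat.succ_le_of_lt (h.lt y)).lt_or_eq with hy | hy
  · exact Or.inl (by dsimp only; omega)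
  · refine Or.inr ⟨by dsimp only; omega, ?_⟩
    calc l x = ellStar P := (h.level_eq x).symm.trans hlx
      _ ≤ l y := Nat.sInf_le ⟨y, (h.isMax_iff y).2 hy, h.level_eq y⟩

/-- If `x` is alone at its level, then its interval is `[l x, l x]`, hence its level is the last
one: the third case of `removeElt` never occurs. -/
lemma removeElt_eq_eraseElt (h : IntervalRep m l r) {x : P} (hx : IsMax x)
    (hlx : level x = ellStar P) : removeElt P x = eraseElt P x := by
  rw [removeElt]
  split_ifs with hcard hlast
  · rfl
  · rfl
  · have halone : (levelSet P (ellStar P)).Subsingleton :=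
      Set.ncard_le_one_iff_subsingleton.1 (not_lt.1 hcard)
    obtain ⟨y, hly, hry⟩ := h.diag (l x) ((h.le x).trans_lt (h.lt x))
    have hlevel : level y = level x := by rw [h.level_eq, h.level_eq, hly]
    obtain rfl : x = y := halone hlx (hlevel.trans hlx)
    rw [h.isMax_iff] at hx
    rw [← hlx, h.level_eq, h.ell_eq] at hlast
    omega

lemma exists_remove_eq [Nonempty P] (h : IntervalRep m l r) :
    ∃ x : P, l x = ellStar P ∧ (∀ y, RightOrder (l y, r y) (l x, r x)) ∧
      remove P = eraseElt P x := by
  have hex : ∃ x : P, IsMax x ∧ level x = ellStar P := exists_isMax_level_eq_ellStar P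
  have hmax := hex.choose_spec.1
  have hlevel := hex.choose_spec.2
  refine ⟨hex.choose, (h.level_eq _).symm.trans hlevel,
    h.rightOrder_of_level_eq_ellStar hmax hlevel, ?_⟩
  rw [remove, dif_pos hex, h.removeElt_eq_eraseElt hmax hlevel]

lemma ascSeq_eq (h : IntervalRep m l r) {L : List (ℕ × ℕ)}
    (hL : (Finset.univ : Finset P).val.map (fun x => (l x, r x)) = L)
    (hsorted : L.Pairwise RightOrder) : ascSeq L.length P = L.map Prod.fst := by
  induction L using List.reverseRecOn generalizing P m l r with
  | nil => rfl
  | append_singleton L p ih =>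
    have hmem : ∀ q, q ∈ L ++ [p] ↔ ∃ x : P, (l x, r x) = q := fun q => by
      rw [← Multiset.mem_coe, ← hL]
      simp
    obtain ⟨z, hz⟩ := (hmem p).1 (by simp)
    have : Nonempty P := ⟨z⟩
    obtain ⟨x, hlx, hlast, hremove⟩ := h.exists_remove_eq
    rw [List.pairwise_append] at hsorted
    have hp : p = (l x, r x) := by
      refine RightOrder.antisymm (hz ▸ hlast z) ?_
      rcases List.mem_append.1 ((hmem _).2 ⟨x, rfl⟩) with hx | hx
      · exact hsorted.2.2 _ hx p (List.mem_singleton_self p)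
      · rw [List.mem_singleton.1 hx]
        exact Or.inr ⟨rfl, le_rfl⟩
    obtain ⟨m', h'⟩ := h.erase hlast
    have hL' : (Finset.univ : Finset (eraseElt P x)).val.map
        (fun y => (l y.1, r y.1)) = L := by
      have hcons := @map_univ_val_eq_cons _ _ _ x (eraseElt P x).isFintype fun x => (l x, r x)
      rw [hL, hp, ← Multiset.coe_add, Multiset.add_comm, Multiset.coe_singleton,
        Multiset.singleton_add] at hcons
      exact ((Multiset.cons_inj_right _).1 hcons).symm
    rw [List.length_append, List.length_singleton, ascSeq, hremove,
      ih (P := eraseElt P x) h' hL' hsorted.1, List.map_append, List.map_singleton, hp, hlx]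

end IntervalRep

/-! ### The permutation of a self-modified ascent sequence -/

/-- Self-modified ascent sequences `b 1, ..., b n`: every entry is the least value not used before,
or it is at most its predecessor. -/
def IsSelfModified (b : ℕ → ℕ) (n : ℕ) : Prop :=
  ∀ k < n, (Finset.Icc 1 k).image b = Finset.range (b (k + 1)) ∨ 0 < k ∧ b (k + 1) ≤ b k

/-- The number of distinct values, called levels, among `b 1, ..., b k`. -/
def levelCount (b : ℕ → ℕ) (k : ℕ) : ℕ :=
  ((Finset.Icc 1 k).image b).card

/-- The number of labels `1, ..., k` at levels below `i`. -/
def levelOffset (b : ℕ → ℕ) (k i : ℕ) : ℕ :=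
  ((Finset.Icc 1 k).filter (b · < i)).card

/-- Comparison of labels by increasing level and, within a level, by decreasing label. -/
def LevelOrder (b : ℕ → ℕ) (u v : ℕ) : Prop :=
  b u < b v ∨ b u = b v ∧ v < u

instance (b : ℕ → ℕ) : Std.Asymm (LevelOrder b) where
  asymm u v huv hvu := by
    unfold LevelOrder at huv hvu
    omega

/-- The word `w` lists the labels `1, ..., k` in level order. -/
structure IsLevelWord (b : ℕ → ℕ) (k : ℕ) (w : List ℕ) : Prop where
  mem_iff : ∀ v, v ∈ w ↔ v ∈ Finset.Icc 1 k
  pairwise : w.Pairwise (LevelOrder b)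

lemma exists_append_of_pairwise {α : Type*} {p : α → Prop} {w : List α}
    (hw : w.Pairwise fun u v => p v → p u) :
    ∃ A B, w = A ++ B ∧ (∀ u ∈ A, p u) ∧ ∀ u ∈ B, ¬ p u := by
  induction w with
  | nil => exact ⟨[], [], by simp⟩
  | cons x w ih =>
    rw [List.pairwise_cons] at hw
    by_cases hx : p x
    · obtain ⟨A, B, rfl, hA, hB⟩ := ih hw.2
      exact ⟨x :: A, B, rfl, List.forall_mem_cons.2 ⟨hx, hA⟩, hB⟩
    · exact ⟨[], x :: w, rfl, by simp,
        List.forall_mem_cons.2 ⟨hx, fun u hu => mt (hw.1 u hu) hx⟩⟩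

lemma insertIdx_length_append {α : Type*} (A B : List α) (x : α) :
    (A ++ B).insertIdx A.length x = A ++ x :: B := by
  induction A with
  | nil => simp
  | cons y A ih => simpa using ih

section LevelWords

variable {b : ℕ → ℕ} {n k : ℕ}

namespace IsSelfModified

lemma image_eq_range (hb : IsSelfModified b n) (hk : k ≤ n) :
    (Finset.Icc 1 k).image b = Finset.range (levelCount b k) := by
  suffices ∃ c, (Finset.Icc 1 k).image b = Finset.range c by
    obtain ⟨c, hc⟩ := this
    rw [levelCount, hc, Finset.card_range]
  induction k with
  | zero => exact ⟨0, rfl⟩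
  | succ k ih =>
    have hIcc : Finset.Icc 1 (k + 1) = insert (k + 1) (Finset.Icc 1 k) :=
      (Finset.insert_Icc_right_eq_Icc_succ (by simp)).symm
    rw [hIcc, Finset.image_insert]
    rcases hb k hk with hnew | ⟨hpos, hle⟩
    · exact ⟨b (k + 1) + 1, by rw [hnew, Finset.range_add_one]⟩
    · obtain ⟨c, hc⟩ := ih (by omega)
      have hbk : b k ∈ Finset.range c := hc ▸ Finset.mem_image_of_mem b (by simp; omega)
      refine ⟨c, ?_⟩
      rw [hc, Finset.insert_eq_of_mem (Finset.mem_range.2 (hle.trans_lt (Finset.mem_range.1 hbk)))]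

lemma lt_levelCount_iff (hb : IsSelfModified b n) (hk : k ≤ n) {i : ℕ} :
    i < levelCount b k ↔ ∃ v ∈ Finset.Icc 1 k, b v = i := by
  rw [← Finset.mem_range, ← hb.image_eq_range hk, Finset.mem_image]

lemma lt_levelCount (hb : IsSelfModified b n) (hk : k ≤ n) {v : ℕ} (hv : v ∈ Finset.Icc 1 k) :
    b v < levelCount b k :=
  (hb.lt_levelCount_iff hk).2 ⟨v, hv, rfl⟩

lemma le_levelCount (hb : IsSelfModified b n) (hk : k < n) : b (k + 1) ≤ levelCount b k := by
  rcases hb k hk with hnew | ⟨hpos, hle⟩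
  · rw [levelCount, hnew, Finset.card_range]
  · exact hle.trans (hb.lt_levelCount hk.le (Finset.right_mem_Icc.2 hpos)).le

lemma levelOffset_strictMonoOn (hb : IsSelfModified b n) (hk : k ≤ n) :
    StrictMonoOn (levelOffset b k) (Set.Iic (levelCount b k)) := by
  intro i _ j hj hij
  obtain ⟨v, hv, rfl⟩ := (hb.lt_levelCount_iff hk).1 (hij.trans_le hj)
  refine Finset.card_lt_card ((Finset.ssubset_iff_of_subset ?_).2 ⟨v, ?_, ?_⟩)
  · exact Finset.monotone_filter_right _ fun u _ hu => hu.trans hij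
  · exact Finset.mem_filter.2 ⟨hv, hij⟩
  · simp

end IsSelfModified

namespace IsLevelWord

variable {w A B : List ℕ} {v : ℕ}

lemma length_eq (hw : IsLevelWord b k w) : w.length = k := by
  rw [← List.toFinset_card_of_nodup hw.pairwise.nodup,
    show w.toFinset = Finset.Icc 1 k from Finset.ext fun v => by rw [List.mem_toFinset, hw.mem_iff],
    Nat.card_Icc, Nat.add_sub_cancel]

lemma eq_of_isLevelWord {w' : List ℕ} (hw : IsLevelWord b k w) (hw' : IsLevelWord b k w') :
    w = w' :=
  hw.pairwise.eq_of_mem_iff hw'.pairwise fun v => by rw [hw.mem_iff, hw'.mem_iff]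

lemma pairwise_le (hw : IsLevelWord b k w) : w.Pairwise fun u v => b u ≤ b v :=
  hw.pairwise.imp fun huv => huv.elim le_of_lt fun heq => heq.1.le

lemma length_eq_levelOffset (hw : IsLevelWord b k (A ++ B)) {i : ℕ} (hA : ∀ u ∈ A, b u < i)
    (hB : ∀ u ∈ B, i ≤ b u) : A.length = levelOffset b k i := by
  rw [levelOffset, ← List.toFinset_card_of_nodup (List.nodup_append.1 hw.pairwise.nodup).1]
  congr 1
  ext u
  rw [List.mem_toFinset, Finset.mem_filter, ← hw.mem_iff, List.mem_append]
  constructor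
  · exact fun hu => ⟨Or.inl hu, hA u hu⟩
  · rintro ⟨hu | hu, hlt⟩
    · exact hu
    · exact absurd hlt (hB u hu).not_gt

lemma exists_append (hw : IsLevelWord b k w) (i : ℕ) :
    ∃ A B, w = A ++ B ∧ A.length = levelOffset b k i ∧ (∀ u ∈ A, b u < i) ∧ ∀ u ∈ B, i ≤ b u := by
  obtain ⟨A, B, rfl, hA, hB⟩ := exists_append_of_pairwise (p := fun u => b u < i)
    (hw.pairwise_le.imp fun huv hv => huv.trans_lt hv)
  have hB' : ∀ u ∈ B, i ≤ b u := fun u hu => not_lt.1 (hB u hu)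
  exact ⟨A, B, rfl, hw.length_eq_levelOffset hA hB', hA, hB'⟩

lemma lt_of_pred_mem (hb : IsSelfModified b n) (hk : k ≤ n)
    (hw : IsLevelWord b k (A ++ (v + 1) :: B)) (hv : v = 0 ∨ v ∈ A) :
    ∀ u ∈ B, b (v + 1) < b u := by
  obtain ⟨-, hvB, hAv⟩ := List.pairwise_append.1 hw.pairwise
  intro u hu
  refine ((List.pairwise_cons.1 hvB).1 u hu).resolve_right fun ⟨hbu, huv⟩ => ?_
  have hu1 : 1 ≤ u := (Finset.mem_Icc.1 ((hw.mem_iff u).1 (by simp [hu]))).1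
  have hvk : v + 1 ≤ k := (Finset.mem_Icc.1 ((hw.mem_iff (v + 1)).1 (by simp))).2
  have huv' : u ≤ v := Nat.lt_succ_iff.1 huv
  have hvA : v ∈ A := hv.resolve_left (by omega)
  have hpred : b v < b (v + 1) := (hAv v hvA (v + 1) (by simp)).resolve_right fun h => by omega
  rcases hb v (by omega) with hnew | ⟨-, hle⟩
  · have hu : b u ∈ Finset.range (b (v + 1)) :=
      hnew ▸ Finset.mem_image_of_mem b (Finset.mem_Icc.2 ⟨hu1, huv'⟩)
    exact (Finset.mem_range.1 hu).ne hbu.symm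
  · exact hle.not_gt hpred

lemma pred_mem_of_lt (hb : IsSelfModified b n) (hk : k ≤ n)
    (hw : IsLevelWord b k (A ++ (v + 1) :: B)) (hB : ∀ u ∈ B, b (v + 1) < b u) :
    v = 0 ∨ v ∈ A := by
  have hvk : v + 1 ≤ k := (Finset.mem_Icc.1 ((hw.mem_iff (v + 1)).1 (by simp))).2
  have hleft : ∀ u ∈ Finset.Icc 1 v, b u ≤ b (v + 1) → u ∈ A := fun u hu hle => by
    rw [Finset.mem_Icc] at hu
    have huw := (hw.mem_iff u).2 (Finset.mem_Icc.2 ⟨hu.1, by omega⟩)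
    rcases List.mem_append.1 huw with huA | huB
    · exact huA
    · rcases List.mem_cons.1 huB with rfl | huB
      · omega
      · exact absurd (hB u huB) hle.not_gt
  refine or_iff_not_imp_left.2 fun hv => ?_
  have hvv : v ∈ Finset.Icc 1 v := Finset.right_mem_Icc.2 (by omega)
  rcases hb v (by omega) with hnew | ⟨-, hle⟩
  · exact hleft v hvv (Finset.mem_range.1 (hnew ▸ Finset.mem_image_of_mem b hvv)).le
  · obtain ⟨u, hu, hbu⟩ := (hb.lt_levelCount_iff (by omega : v ≤ n)).1
      (hle.trans_lt (hb.lt_levelCount (by omega) hvv))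
    have huv := (List.pairwise_append.1 hw.pairwise).2.2 u (hleft u hu hbu.le) (v + 1) (by simp)
    rw [Finset.mem_Icc] at hu
    unfold LevelOrder at huv
    omega

lemma length_mem_activeSites_iff (hb : IsSelfModified b n) (hk : k ≤ n)
    (hw : IsLevelWord b k (A ++ B)) :
    A.length ∈ activeSites (A ++ B) ↔ ∀ u ∈ A, ∀ v ∈ B, b u < b v := by
  rcases List.eq_nil_or_concat' A with rfl | ⟨A, v, rfl⟩
  · simp [activeSites]
  rcases eq_or_ne B [] with rfl | hB
  · simp [activeSites]
  obtain ⟨v, rfl⟩ : ∃ v', v = v' + 1 :=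
    Nat.exists_eq_add_of_le' (Finset.mem_Icc.1 ((hw.mem_iff v).1 (by simp))).1
  have hsite : (A ++ [v + 1]).length ∈ activeSites (A ++ [v + 1] ++ B) ↔ v = 0 ∨ v ∈ A := by
    simp [activeSites, hB]
  have hle : ∀ u ∈ A, b u ≤ b (v + 1) := fun u hu =>
    (List.pairwise_append.1 (List.pairwise_append.1 hw.pairwise_le).1).2.2 u hu _ (by simp)
  rw [List.append_assoc, List.singleton_append] at hw
  rw [hsite, Iff.intro (hw.lt_of_pred_mem hb hk) (hw.pred_mem_of_lt hb hk)]
  constructor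
  · intro hlt u hu x hx
    rcases List.mem_append.1 hu with hu | hu
    · exact (hle u hu).trans_lt (hlt x hx)
    · exact List.mem_singleton.1 hu ▸ hlt x hx
  · exact fun hlt => hlt (v + 1) (by simp)

lemma mem_activeSites_iff (hb : IsSelfModified b n) (hk : k ≤ n) (hw : IsLevelWord b k w) {j : ℕ} :
    j ∈ activeSites w ↔ ∃ i ≤ levelCount b k, levelOffset b k i = j := by
  constructor
  · intro hj
    have hjw : j ≤ w.length := Nat.lt_succ_iff.1 (List.mem_range.1 (List.mem_of_mem_filter hj))
    obtain ⟨A, B, rfl, rfl⟩ : ∃ A B, w = A ++ B ∧ A.length = j :=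
      ⟨w.take j, w.drop j, (List.take_append_drop j w).symm, List.length_take_of_le hjw⟩
    rw [hw.length_mem_activeSites_iff hb hk] at hj
    have hlt : ∀ u ∈ A ++ B, b u < levelCount b k := fun u hu =>
      hb.lt_levelCount hk ((hw.mem_iff u).1 hu)
    cases B with
    | nil => exact ⟨levelCount b k, le_rfl,
        (hw.length_eq_levelOffset (fun u hu => hlt u (by simp [hu])) (by simp)).symm⟩
    | cons v B =>
      have hv := (List.pairwise_cons.1 (List.pairwise_append.1 hw.pairwise_le).2.1).1
      exact ⟨b v, (hlt v (by simp)).le, (hw.length_eq_levelOffset (fun u hu => hj u hu v (by simp))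
        (List.forall_mem_cons.2 ⟨le_rfl, hv⟩)).symm⟩
  · rintro ⟨i, -, rfl⟩
    obtain ⟨A, B, rfl, hlen, hA, hB⟩ := hw.exists_append i
    rw [← hlen, hw.length_mem_activeSites_iff hb hk]
    exact fun u hu v hv => (hA u hu).trans_le (hB v hv)

lemma activeSites_eq (hb : IsSelfModified b n) (hk : k ≤ n) (hw : IsLevelWord b k w) :
    activeSites w = (List.range (levelCount b k + 1)).map (levelOffset b k) := by
  have hsites : (activeSites w).Pairwise (· < ·) := List.pairwise_lt_range.filter _
  have hoffsets : ((List.range (levelCount b k + 1)).map (levelOffset b k)).Pairwise (· < ·) := by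
    rw [List.pairwise_map]
    refine List.pairwise_lt_range.imp_of_mem fun hi hj hij => ?_
    rw [List.mem_range, Nat.lt_succ_iff] at hi hj
    exact hb.levelOffset_strictMonoOn hk hi hj hij
  refine hsites.eq_of_mem_iff hoffsets fun j => ?_
  simp only [hw.mem_activeSites_iff hb hk, List.mem_map, List.mem_range, Nat.lt_succ_iff]

lemma insertNext (hb : IsSelfModified b n) (hk : k < n) (hw : IsLevelWord b k w) :
    IsLevelWord b (k + 1) (insertNext w (b (k + 1))) := by
  have hsite : (activeSites w).getD (b (k + 1)) 0 = levelOffset b k (b (k + 1)) := by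
    have hlt : b (k + 1) < levelCount b k + 1 := Nat.lt_succ_of_le (hb.le_levelCount hk)
    rw [hw.activeSites_eq hb hk.le, List.getD_eq_getElem _ _ (by simpa using hlt),
      List.getElem_map, List.getElem_range]
  obtain ⟨A, B, rfl, hlen, hA, hB⟩ := hw.exists_append (b (k + 1))
  rw [PosetDuality.insertNext, hsite, hw.length_eq, ← hlen, insertIdx_length_append]
  have hmem : ∀ v, v ∈ A ∨ v ∈ B ↔ 1 ≤ v ∧ v ≤ k := fun v => by
    rw [← List.mem_append, hw.mem_iff, Finset.mem_Icc]
  obtain ⟨hpA, hpB, hAB⟩ := List.pairwise_append.1 hw.pairwise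
  refine ⟨fun v => ?_, List.pairwise_append.2 ⟨hpA, List.pairwise_cons.2 ⟨fun v hv => ?_, hpB⟩, ?_⟩⟩
  · rw [List.mem_append, List.mem_cons, Finset.mem_Icc, or_left_comm, hmem]
    omega
  · exact (hB v hv).lt_or_eq.imp_right fun heq => ⟨heq, by have := (hmem v).1 (.inr hv); omega⟩
  · exact fun u hu => List.forall_mem_cons.2 ⟨.inl (hA u hu), hAB u hu⟩

end IsLevelWord

lemma IsSelfModified.isLevelWord_fAS (hb : IsSelfModified b n) (hk : k ≤ n) :
    IsLevelWord b k (fAS ((List.range k).map fun j => b (j + 1))) := by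
  induction k with
  | zero => exact ⟨by simp [fAS], List.Pairwise.nil⟩
  | succ k ih =>
    rw [fAS, List.range_succ, List.map_append, List.foldl_append]
    exact (ih (by omega)).insertNext hb hk

end LevelWords

/-! ### Codings -/

/-- The labels `i : Fin n` carry intervals `[l i, r i]`, all one-point intervals occurring; the
labels are sorted by increasing `r` and then decreasing `l`, and `π` lists them by increasing `l`
and then decreasing label. -/
structure IsCoding {n : ℕ} (π : Equiv.Perm (Fin n)) (m : ℕ) (l r : Fin n → ℕ) : Prop extends
    IntervalFamily m l r where
  monotone_r : Monotone r
  antitoneOn_l : ∀ k, AntitoneOn l {i | r i = k}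
  monotone_l_comp : Monotone (l ∘ π)
  antitoneOn_apply : ∀ k, AntitoneOn π {p | l (π p) = k}

open Classical in
/-- The labels `v` that are minimal or whose predecessor stands to the left of `v` in `π`, i.e.
the labels `v` such that the site after `v` is active. -/
noncomputable def records {n : ℕ} (π : Equiv.Perm (Fin n)) : Finset (Fin n) :=
  {v | ∀ u, u ⋖ v → π.symm u < π.symm v}

/-- The number of records to the left of `v`: the left endpoint of `v` in a coding of `π`. -/
noncomputable def leftEnd {n : ℕ} (π : Equiv.Perm (Fin n)) (v : Fin n) : ℕ :=
  ((records π).filter fun u => π.symm u < π.symm v).card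

/-- The number of records below `v`, or up to `v` without the record `0`: the right endpoint of
`v` in a coding of `π`. -/
noncomputable def rightEnd {n : ℕ} (π : Equiv.Perm (Fin n)) (v : Fin n) : ℕ :=
  ((records π).filter (· ≤ v)).card - 1

section Records

variable {n : ℕ} {π : Equiv.Perm (Fin n)} {u v : Fin n}

lemma mem_records : v ∈ records π ↔ ∀ u, u ⋖ v → π.symm u < π.symm v := by
  simp [records]

end Records

namespace IsCoding

variable {n m : ℕ} {π : Equiv.Perm (Fin n)} {l r : Fin n → ℕ} {u v : Fin n}

lemma symm_lt_symm_iff (h : IsCoding π m l r) :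
    π.symm u < π.symm v ↔ l u < l v ∨ l u = l v ∧ v < u := by
  have key : ∀ {u v}, π.symm u < π.symm v → l u < l v ∨ l u = l v ∧ v < u := fun {u v} huv => by
    have hle : l u ≤ l v := by simpa using h.monotone_l_comp huv.le
    refine hle.lt_or_eq.imp_right fun heq => ⟨heq, lt_of_le_of_ne ?_ ?_⟩
    · simpa using h.antitoneOn_apply (l v) (a := π.symm u) (by simpa using heq) (by simp) huv.le
    · rintro rfl
      exact huv.false
  refine ⟨key, fun hlt => ?_⟩
  by_contra hge
  rcases (not_lt.1 hge).lt_or_eq with hvu | heq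
  · rcases key hvu with h' | h' <;> omega
  · obtain rfl := π.symm.injective heq
    omega

lemma lt_or_of_lt (h : IsCoding π m l r) (huv : u < v) : r u < r v ∨ r u = r v ∧ l v ≤ l u :=
  (h.monotone_r huv.le).lt_or_eq.imp_right fun heq => ⟨heq, h.antitoneOn_l (r v) heq rfl huv.le⟩

lemma l_eq_r_of_forall_lt (h : IsCoding π m l r) (hv : ∀ u < v, r u < r v) : l v = r v := by
  obtain ⟨j, hlj, hrj⟩ := h.diag (r v) (h.lt v)
  have hvj : v ≤ j := not_lt.1 fun hjv => (hv j hjv).ne hrj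
  refine (h.le v).antisymm ?_
  rw [← hlj]
  exact h.antitoneOn_l (r v) rfl hrj hvj

lemma mem_records_iff (h : IsCoding π m l r) : v ∈ records π ↔ ∀ u < v, r u < r v := by
  rw [mem_records]
  constructor
  · intro hv u huv
    obtain ⟨w, huw, hwv⟩ := exists_le_covBy_of_lt huv
    have hlt := h.symm_lt_symm_iff.1 (hv w hwv)
    have hor := h.lt_or_of_lt hwv.lt
    have hmono := h.monotone_r huw
    have := hwv.lt
    omega
  · intro hv u huv
    refine h.symm_lt_symm_iff.2 (Or.inl ?_)
    calc l u ≤ r u := h.le u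
      _ < r v := hv u huv.lt
      _ = l v := (h.l_eq_r_of_forall_lt hv).symm

lemma l_eq_r (h : IsCoding π m l r) (hv : v ∈ records π) : l v = r v :=
  h.l_eq_r_of_forall_lt (h.mem_records_iff.1 hv)

lemma strictMonoOn_r (h : IsCoding π m l r) : StrictMonoOn r (records π) :=
  fun u _ _ hv huv => h.mem_records_iff.1 hv u huv

lemma exists_mem_records (h : IsCoding π m l r) {k : ℕ} (hk : k < m) :
    ∃ v ∈ records π, r v = k := by
  obtain ⟨j, -, hj⟩ := h.diag k hk
  obtain ⟨v, rfl, hmin⟩ := WellFounded.has_min wellFounded_lt {i | r i = k} ⟨j, hj⟩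
  exact ⟨v, h.mem_records_iff.2 fun u huv =>
    (h.monotone_r huv.le).lt_of_ne fun heq => hmin u heq huv, rfl⟩

lemma card_records_filter_lt (h : IsCoding π m l r) {c : ℕ} (hc : c ≤ m) :
    ((records π).filter (r · < c)).card = c := by
  have himage : ((records π).filter (r · < c)).image r = Finset.range c := by
    ext k
    simp only [Finset.mem_image, Finset.mem_filter, Finset.mem_range]
    constructor
    · rintro ⟨v, ⟨-, hv⟩, rfl⟩
      exact hv
    · intro hk
      obtain ⟨v, hv, rfl⟩ := h.exists_mem_records (hk.trans_le hc)
      exact ⟨v, ⟨hv, hk⟩, rfl⟩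
  have hinj : Set.InjOn r ((records π).filter (r · < c)) :=
    h.strictMonoOn_r.injOn.mono (Finset.coe_subset.2 (Finset.filter_subset _ _))
  rw [← Finset.card_image_of_injOn hinj, himage, Finset.card_range]

lemma r_eq (h : IsCoding π m l r) : r = rightEnd π := by
  funext v
  have hfilter : (records π).filter (· ≤ v) = (records π).filter (r · < r v + 1) :=
    Finset.filter_congr fun u hu => ⟨fun huv => Nat.lt_add_one_of_le (h.monotone_r huv),
      fun huv => not_lt.1 fun hvu => by have := h.mem_records_iff.1 hu v hvu; omega⟩
  rw [rightEnd, hfilter, h.card_records_filter_lt (Nat.add_one_le_of_lt (h.lt v)),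
    Nat.add_sub_cancel]

lemma l_eq (h : IsCoding π m l r) : l = leftEnd π := by
  funext v
  have hfilter : (records π).filter (π.symm · < π.symm v) = (records π).filter (r · < l v) := by
    refine Finset.filter_congr fun u hu => ?_
    rw [h.symm_lt_symm_iff, h.l_eq_r hu]
    refine or_iff_left fun ⟨_, hvu⟩ => ?_
    have := h.mem_records_iff.1 hu v hvu
    have := h.le v
    omega
  rw [leftEnd, hfilter, h.card_records_filter_lt ((h.le v).trans (h.lt v).le)]

lemma isSelfModified (h : IsCoding π m l r) {b : ℕ → ℕ} (hb : ∀ i : Fin n, b (i + 1) = l i) :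
    IsSelfModified b n := by
  intro k hk
  rw [hb ⟨k, hk⟩]
  by_cases hv : ⟨k, hk⟩ ∈ records π
  · left
    rw [h.l_eq_r hv]
    ext j
    simp only [Finset.mem_image, Finset.mem_Icc, Finset.mem_range]
    constructor
    · rintro ⟨i, ⟨hi, hik⟩, rfl⟩
      obtain ⟨i, rfl⟩ := Nat.exists_eq_add_of_le' hi
      rw [hb ⟨i, by omega⟩]
      exact (h.le _).trans_lt (h.mem_records_iff.1 hv _ hik)
    · intro hj
      obtain ⟨u, hlu, hru⟩ := h.diag j (hj.trans (h.lt _))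
      have huv : u < ⟨k, hk⟩ := h.monotone_r.reflect_lt (hru.trans_lt hj)
      exact ⟨u + 1, ⟨by omega, huv⟩, (hb u).trans hlu⟩
  · right
    rw [mem_records] at hv
    push Not at hv
    obtain ⟨u, huv, hsymm⟩ := hv
    obtain rfl : (u : ℕ) + 1 = k := Nat.covBy_iff_add_one_eq.1 (Fin.covBy_iff.1 huv)
    refine ⟨Nat.succ_pos _, ?_⟩
    rw [hb u]
    exact not_lt.1 fun hlt => hsymm.not_gt (h.symm_lt_symm_iff.2 (.inl hlt))

lemma isLevelWord_oneLine (h : IsCoding π m l r) {b : ℕ → ℕ} (hb : ∀ i : Fin n, b (i + 1) = l i) :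
    IsLevelWord b n (oneLine π) where
  mem_iff v := by
    rw [oneLine, List.mem_ofFn, Finset.mem_Icc]
    constructor
    · rintro ⟨i, rfl⟩
      omega
    · rintro ⟨hv, hvn⟩
      obtain ⟨v, rfl⟩ := Nat.exists_eq_add_of_le' hv
      exact ⟨π.symm ⟨v, hvn⟩, by simp⟩
  pairwise := by
    rw [oneLine, List.pairwise_ofFn]
    intro i j hij
    simpa [LevelOrder, hb] using h.symm_lt_symm_iff (u := π i) (v := π j).1 (by simpa using hij)

lemma fAS_ofFn (h : IsCoding π m l r) : fAS (List.ofFn l) = oneLine π := by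
  let b : ℕ → ℕ := Function.extend (fun i : Fin n => (i : ℕ) + 1) l 0
  have hb : ∀ i : Fin n, b (i + 1) = l i := fun i =>
    Function.Injective.extend_apply (fun i j hij => Fin.ext (Nat.succ_injective hij)) l 0 i
  have hrange : (List.range n).map (fun j => b (j + 1)) = List.ofFn l :=
    List.ext_getElem (by simp) fun i hi _ => by simpa using hb ⟨i, by simpa using hi⟩
  rw [← hrange]
  exact ((h.isSelfModified hb).isLevelWord_fAS le_rfl).eq_of_isLevelWord (h.isLevelWord_oneLine hb)

lemma dual (h : IsCoding π m l r) :
    IsCoding (compl (rev π))⁻¹ m (fun i => m - 1 - r (π i.rev)) (fun i => m - 1 - l (π i.rev)) where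
  toIntervalFamily := h.toIntervalFamily.dual.comp_surjective
    (Fin.revPerm.trans π).surjective
  monotone_r i j hij := Nat.sub_le_sub_left (h.monotone_l_comp (Fin.rev_le_rev.2 hij)) _
  antitoneOn_l k i hi j hj hij := by
    have hl : l (π i.rev) = l (π j.rev) := by
      have := (h.le (π i.rev)).trans_lt (h.lt _)
      have := (h.le (π j.rev)).trans_lt (h.lt _)
      simp only [Set.mem_ofPred_eq] at hi hj
      omega
    exact Nat.sub_le_sub_left
      (h.monotone_r (h.antitoneOn_apply _ hl.symm rfl (Fin.rev_le_rev.2 hij))) _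
  monotone_l_comp i j hij := by
    have hinv : ∀ a, (compl (rev π))⁻¹ a = (π.symm a.rev).rev := fun a => rfl
    simp only [Function.comp_apply, hinv, Fin.rev_rev, Equiv.apply_symm_apply]
    exact Nat.sub_le_sub_left (h.monotone_r (Fin.rev_le_rev.2 hij)) _
  antitoneOn_apply k i hi j hj hij := by
    have hinv : ∀ a, (compl (rev π))⁻¹ a = (π.symm a.rev).rev := fun a => rfl
    simp only [Set.mem_ofPred_eq, hinv, Fin.rev_rev, Equiv.apply_symm_apply] at hi hj
    rw [hinv, hinv, Fin.rev_le_rev]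
    refine not_lt.1 fun hlt => ?_
    have hr : r j.rev = r i.rev := by
      have := h.lt i.rev
      have := h.lt j.rev
      omega
    have hl := h.antitoneOn_l _ hr rfl (Fin.rev_le_rev.2 hij)
    rcases h.symm_lt_symm_iff.1 hlt with hlt | ⟨-, hlt⟩
    · exact hl.not_gt hlt
    · exact (Fin.rev_lt_rev.1 hlt).not_ge hij

end IsCoding

/-! ### The coding of a barred-pattern avoiding permutation -/

section Records

variable {n : ℕ} {π : Equiv.Perm (Fin n)} {u v : Fin n}

lemma rightEnd_add_one (v : Fin n) :
    rightEnd π v + 1 = ((records π).filter (· ≤ v)).card := by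
  refine Nat.sub_add_cancel (Finset.card_pos.2 ⟨⟨0, v.pos⟩, Finset.mem_filter.2 ⟨?_, ?_⟩⟩)
  · exact mem_records.2 fun u hu => absurd hu.lt (Nat.not_lt_zero u)
  · exact Nat.zero_le v

lemma leftEnd_le_leftEnd (huv : π.symm u ≤ π.symm v) : leftEnd π u ≤ leftEnd π v :=
  Finset.card_le_card
    (Finset.monotone_filter_right _ fun w _ (hw : π.symm w < π.symm u) => hw.trans_le huv)

lemma leftEnd_monotone_comp : Monotone (leftEnd π ∘ π) := fun _ _ hpq =>
  leftEnd_le_leftEnd (by simpa using hpq)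

lemma rightEnd_monotone : Monotone (rightEnd π) := fun _ _ huv =>
  Nat.sub_le_sub_right
    (Finset.card_le_card (Finset.monotone_filter_right _ fun _ _ hw => hw.trans huv)) 1

lemma leftEnd_lt_leftEnd (hu : u ∈ records π) (huv : π.symm u < π.symm v) :
    leftEnd π u < leftEnd π v := by
  refine Finset.card_lt_card ((Finset.ssubset_iff_of_subset ?_).2
    ⟨u, Finset.mem_filter.2 ⟨hu, huv⟩, by simp⟩)
  exact Finset.monotone_filter_right _ fun w _ hw => hw.trans huv

lemma rightEnd_lt_rightEnd (hv : v ∈ records π) (huv : u < v) : rightEnd π u < rightEnd π v := by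
  rw [← Nat.add_lt_add_iff_right (k := 1), rightEnd_add_one, rightEnd_add_one]
  refine Finset.card_lt_card ((Finset.ssubset_iff_of_subset ?_).2
    ⟨v, Finset.mem_filter.2 ⟨hv, le_rfl⟩, by simp [huv]⟩)
  exact Finset.monotone_filter_right _ fun w _ hw => hw.trans huv.le

lemma rightEnd_lt_card_records (v : Fin n) : rightEnd π v < (records π).card := by
  rw [← Nat.add_one_le_iff, rightEnd_add_one]
  exact Finset.card_filter_le _ _

lemma exists_mem_records_rightEnd_eq {k : ℕ} (hk : k < (records π).card) :
    ∃ v ∈ records π, rightEnd π v = k := by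
  have hstrict : StrictMonoOn (rightEnd π) (records π) := fun _ _ _ hv => rightEnd_lt_rightEnd hv
  exact Finset.surjOn_of_injOn_of_card_le (t := Finset.range (records π).card) (rightEnd π)
    (fun v _ => by simpa using rightEnd_lt_card_records v) hstrict.injOn (by simp)
    (by simpa using hk)

lemma antitoneOn_symm_rightEnd (k : ℕ) : AntitoneOn π.symm {v | rightEnd π v = k} := by
  refine antitoneOn_of_succ_le (Set.ordConnected_singleton.preimage_mono rightEnd_monotone) ?_
  intro u hu huk hsk
  have hcov : u ⋖ Order.succ u := Order.covBy_succ_of_not_isMax hu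
  have hnot : Order.succ u ∉ records π := fun hrec =>
    (rightEnd_lt_rightEnd hrec hcov.lt).ne (huk.trans hsk.symm)
  rw [mem_records] at hnot
  push Not at hnot
  obtain ⟨w, hw, hle⟩ := hnot
  rwa [hw.unique_left hcov] at hle

end Records

namespace AvoidsBarred

variable {n : ℕ} {π : Equiv.Perm (Fin n)} {u v p q : Fin n}

lemma lt_of_mem_records (hπ : AvoidsBarred π) (hu : u ∈ records π)
    (huv : π.symm u < π.symm v) : u < v := by
  by_contra hvu
  have hvu : v < u := (not_lt.1 hvu).lt_of_ne fun h => huv.ne (h ▸ rfl)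
  obtain ⟨w, hvw, hwu⟩ := exists_le_covBy_of_lt hvu
  have hwu' : π.symm w < π.symm u := mem_records.1 hu w hwu
  have hvw : v < w := hvw.lt_of_ne fun h => (hwu'.trans huv).ne (h ▸ rfl)
  obtain ⟨-, m, -, -, -, -, hwm, hmu⟩ := hπ (π.symm w) (π.symm u) (π.symm v) hwu' huv
    (by simpa using hvw) (by simpa using hwu.lt)
  rw [π.apply_symm_apply] at hwm hmu
  exact hwu.2 hwm hmu

lemma apply_lt_apply_of_covBy (hπ : AvoidsBarred π) (hpq : p ⋖ q) (hp : π p ∉ records π) :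
    π q < π p := by
  rw [mem_records] at hp
  push Not at hp
  obtain ⟨u, hu, hle⟩ := hp
  rw [π.symm_apply_apply] at hle
  by_contra hqp
  have hqp : π p < π q := (not_lt.1 hqp).lt_of_ne fun h => hpq.lt.ne (π.injective h)
  have hpu : p < π.symm u := hle.lt_of_ne fun h => hu.lt.ne (by simp [h])
  have hqu : q < π.symm u := by
    refine (hpq.ge_of_gt hpu).lt_of_ne fun h => ?_
    rw [h, π.apply_symm_apply] at hqp
    exact hqp.not_gt hu.lt
  obtain ⟨a, -, hpa, haq, -⟩ := hπ p q (π.symm u) hpq.lt hqu (by simpa using hu.lt) hqp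
  exact hpq.2 hpa haq

lemma antitoneOn_leftEnd_comp (hπ : AvoidsBarred π) (k : ℕ) :
    AntitoneOn π {p | leftEnd π (π p) = k} := by
  refine antitoneOn_of_succ_le
    (Set.ordConnected_singleton.preimage_mono (leftEnd_monotone_comp (π := π))) ?_
  intro p hp hpk hsk
  have hcov : p ⋖ Order.succ p := Order.covBy_succ_of_not_isMax hp
  refine (hπ.apply_lt_apply_of_covBy hcov fun hrec => ?_).le
  exact (leftEnd_lt_leftEnd hrec (by simpa using hcov.lt)).ne (hpk.trans hsk.symm)

lemma leftEnd_eq_rightEnd (hπ : AvoidsBarred π) (hv : v ∈ records π) :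
    leftEnd π v = rightEnd π v := by
  have hsymm : ∀ u ∈ records π, π.symm u < π.symm v ↔ u < v := fun u hu => by
    refine ⟨hπ.lt_of_mem_records hu, fun huv => ?_⟩
    by_contra hvu
    have hvu : π.symm v < π.symm u := (not_lt.1 hvu).lt_of_ne fun h => huv.ne' (π.symm.injective h)
    exact huv.not_gt (hπ.lt_of_mem_records hv hvu)
  have hinsert : (records π).filter (· ≤ v) = insert v ((records π).filter (· < v)) := by
    rw [Finset.filter_congr fun u _ => le_iff_eq_or_lt, Finset.filter_or, Finset.filter_eq',
      if_pos hv, Finset.insert_eq]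
  rw [← Nat.add_right_cancel_iff (n := 1), rightEnd_add_one, hinsert, leftEnd,
    Finset.filter_congr hsymm, Finset.card_insert_of_notMem (by simp)]

lemma leftEnd_le_rightEnd (hπ : AvoidsBarred π) (v : Fin n) : leftEnd π v ≤ rightEnd π v := by
  obtain ⟨u, hu, huv⟩ := exists_mem_records_rightEnd_eq (rightEnd_lt_card_records (π := π) v)
  have hle : u ≤ v := not_lt.1 fun hvu => (rightEnd_lt_rightEnd hu hvu).ne' huv
  have hsymm : π.symm v ≤ π.symm u := antitoneOn_symm_rightEnd _ huv rfl hle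
  calc leftEnd π v ≤ leftEnd π u := leftEnd_le_leftEnd hsymm
    _ = rightEnd π v := (hπ.leftEnd_eq_rightEnd hu).trans huv

lemma isCoding (hπ : AvoidsBarred π) :
    IsCoding π (records π).card (leftEnd π) (rightEnd π) where
  le := hπ.leftEnd_le_rightEnd
  lt := rightEnd_lt_card_records
  diag k hk := by
    obtain ⟨v, hv, rfl⟩ := exists_mem_records_rightEnd_eq hk
    exact ⟨v, hπ.leftEnd_eq_rightEnd hv, rfl⟩
  monotone_r := rightEnd_monotone
  antitoneOn_l k _ hu _ hv huv := leftEnd_le_leftEnd (antitoneOn_symm_rightEnd k hu hv huv)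
  monotone_l_comp := leftEnd_monotone_comp
  antitoneOn_apply := hπ.antitoneOn_leftEnd_comp

end AvoidsBarred

/-! ### Posets encoded by a permutation -/

/-- `π` encodes `P` if `P` is an interval order in which all one-point intervals occur, and `π` is
coded by these intervals once they are labelled by increasing right endpoint and then decreasing
left endpoint. -/
def Encodes {n : ℕ} (π : Equiv.Perm (Fin n)) (P : Type*) [PartialOrder P] : Prop :=
  ∃ (m : ℕ) (l r : P → ℕ) (e : Fin n ≃ P), IntervalRep m l r ∧ IsCoding π m (l ∘ e) (r ∘ e)

/-- The interval order of the intervals `[l i, r i]`. -/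
@[reducible] def intervalOrder {ι : Type*} {l r : ι → ℕ} (h : ∀ i, l i ≤ r i) :
    PartialOrder ι where
  le i j := i = j ∨ r i < l j
  lt i j := r i < l j
  le_refl i := Or.inl rfl
  le_trans i j k := by
    rintro (rfl | hij) (rfl | hjk)
    · exact Or.inl rfl
    · exact Or.inr hjk
    · exact Or.inr hij
    · exact Or.inr (hij.trans_le ((h j).trans hjk.le))
  lt_iff_le_not_ge i j := by
    have hi := h i
    have hj := h j
    constructor
    · refine fun hij => ⟨Or.inr hij, ?_⟩
      rintro (rfl | hji) <;> omega
    · rintro ⟨rfl | hij, hji⟩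
      · exact absurd (Or.inl rfl) hji
      · exact hij
  le_antisymm i j := by
    have hi := h i
    have hj := h j
    rintro (rfl | hij) (hji | hji)
    · rfl
    · rfl
    · exact hji.symm
    · omega

lemma oneLine_injective {n : ℕ} : Function.Injective (oneLine (n := n)) := by
  intro π σ h
  refine Equiv.ext fun i => Fin.ext ?_
  simpa using congrFun (List.ofFn_injective h) i

lemma exists_equiv_monotone {α P : Type*} [LinearOrder α] [Fintype P] (f : P → α) :
    ∃ e : Fin (Fintype.card P) ≃ P, Monotone (f ∘ e) :=
  ⟨(Tuple.sort (f ∘ (Fintype.equivFin P).symm)).trans (Fintype.equivFin P).symm,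
    Tuple.monotone_sort (f ∘ (Fintype.equivFin P).symm)⟩

lemma AvoidsBarred.exists_encodes {n : ℕ} {π : Equiv.Perm (Fin n)} (hπ : AvoidsBarred π) :
    ∃ P : FinPartOrd.{0}, Encodes π P := by
  have h := hπ.isCoding
  let : PartialOrder (Fin n) := intervalOrder h.le
  exact ⟨FinPartOrd.of (Fin n), _, leftEnd π, rightEnd π, Equiv.refl _,
    ⟨h.toIntervalFamily, fun _ _ => Iff.rfl⟩, h⟩

lemma IntervalRep.exists_encodes {P : Type*} [PartialOrder P] [Fintype P] {m : ℕ} {l r : P → ℕ}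
    (h : IntervalRep m l r) : ∃ π : Equiv.Perm (Fin (Fintype.card P)), Encodes π P := by
  obtain ⟨e, he⟩ := exists_equiv_monotone fun x => toLex (r x, OrderDual.toDual (l x))
  have hlabel : ∀ {i j}, i ≤ j →
      r (e i) < r (e j) ∨ r (e i) = r (e j) ∧ l (e j) ≤ l (e i) := fun hij => by
    simpa [Prod.Lex.toLex_le_toLex] using he hij
  let key := fun i => toLex (l (e i), OrderDual.toDual i)
  have hposition : ∀ {p q}, p ≤ q → l (e (Tuple.sort key p)) < l (e (Tuple.sort key q)) ∨
      l (e (Tuple.sort key p)) = l (e (Tuple.sort key q)) ∧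
        Tuple.sort key q ≤ Tuple.sort key p := fun hpq => by
    simpa [key, Prod.Lex.toLex_le_toLex] using Tuple.monotone_sort key hpq
  refine ⟨Tuple.sort key, m, l, r, e, h, h.toIntervalFamily.comp_surjective e.surjective,
    fun i j hij => ?_, fun k i hi j hj hij => ?_, fun p q hpq => ?_, fun k p hp q hq hpq => ?_⟩
  · exact (hlabel hij).elim le_of_lt fun heq => heq.1.le
  · exact ((hlabel hij).resolve_left (hi.trans hj.symm).not_lt).2
  · exact (hposition hpq).elim le_of_lt fun heq => heq.1.le
  · exact ((hposition hpq).resolve_left (hp.trans hq.symm).not_lt).2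

lemma IsRPoset.exists_encodes {n : ℕ} {P : FinPartOrd.{0}} (h : IsRPoset n P) :
    ∃ π : Equiv.Perm (Fin n), Encodes π P := by
  obtain ⟨rfl, hfree, s, hs⟩ := h
  exact (hfree.intervalRep s hs).exists_encodes

namespace Encodes

variable {n : ℕ} {π : Equiv.Perm (Fin n)}

section PartialOrder

variable {P Q : Type*} [PartialOrder P] [PartialOrder Q]

lemma dual (h : Encodes π P) : Encodes (compl (rev π))⁻¹ Pᵒᵈ := by
  obtain ⟨m, l, r, e, hrep, hcod⟩ := h
  refine ⟨m, fun x => m - 1 - r x.ofDual, fun x => m - 1 - l x.ofDual,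
    (Fin.revPerm.trans π).trans (e.trans OrderDual.toDual), ⟨?_, fun x y => ?_⟩, hcod.dual⟩
  · exact hrep.toIntervalFamily.dual.comp_surjective OrderDual.ofDual.surjective
  · exact (hrep.lt_iff _ _).trans hrep.dual_lt_dual_iff.symm

lemma congr (h : Encodes π P) (φ : P ≃o Q) : Encodes π Q := by
  obtain ⟨m, l, r, e, hrep, hcod⟩ := h
  refine ⟨m, l ∘ φ.symm, r ∘ φ.symm, e.trans φ.toEquiv,
    ⟨hrep.toIntervalFamily.comp_surjective φ.symm.surjective, fun x y => ?_⟩, ?_⟩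
  · rw [← φ.symm.lt_iff_lt, hrep.lt_iff, Function.comp_apply, Function.comp_apply]
  · simpa [Function.comp_def] using hcod

lemma exists_equiv_lt_iff (h : Encodes π P) :
    ∃ e : Fin n ≃ P, ∀ i j, e i < e j ↔ rightEnd π i < leftEnd π j := by
  obtain ⟨m, l, r, e, hrep, hcod⟩ := h
  exact ⟨e, fun i j => by rw [hrep.lt_iff, ← hcod.r_eq, ← hcod.l_eq]; rfl⟩

lemma nonempty_orderIso (hP : Encodes π P) (hQ : Encodes π Q) : Nonempty (P ≃o Q) := by
  obtain ⟨e, he⟩ := hP.exists_equiv_lt_iff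
  obtain ⟨e', he'⟩ := hQ.exists_equiv_lt_iff
  have hlt : ∀ x y, e' (e.symm x) < e' (e.symm y) ↔ x < y := fun x y => by
    rw [he', ← he, e.apply_symm_apply, e.apply_symm_apply]
  refine ⟨⟨e.symm.trans e', fun {x y} => ?_⟩⟩
  rw [le_iff_lt_or_eq, le_iff_lt_or_eq, Equiv.trans_apply, Equiv.trans_apply, hlt,
    e'.injective.eq_iff, e.symm.injective.eq_iff]

end PartialOrder

variable {P : FinPartOrd.{0}}

lemma card_eq (h : Encodes π P) : Fintype.card P = n := by
  obtain ⟨m, l, r, e, -⟩ := h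
  rw [← Fintype.card_congr e, Fintype.card_fin]

lemma isRPoset (h : Encodes π P) (hn : 1 ≤ n) : IsRPoset n P := by
  have hcard := h.card_eq
  obtain ⟨m, l, r, e, hrep, -⟩ := h
  have : Nonempty P := ⟨e ⟨0, hn⟩⟩
  exact ⟨hcard, hrep.isTwoPlusTwoFree, hrep.exists_ltSeries⟩

lemma fPS_eq (h : Encodes π P) : fPS P = oneLine π := by
  have hcard := h.card_eq
  obtain ⟨m, l, r, e, hrep, hcod⟩ := h
  have hcount : (Finset.univ : Finset P).val.map (fun x => (l x, r x)) =
      List.ofFn fun i => (l (e i), r (e i)) := by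
    rw [← Finset.univ_map_equiv_to_embedding e, Finset.map_val, Multiset.map_map]
    simp [List.ofFn_eq_map, Fin.univ_val_map]
  have hsorted : (List.ofFn fun i => (l (e i), r (e i))).Pairwise RightOrder :=
    List.pairwise_ofFn.2 fun i j hij => hcod.lt_or_of_lt hij
  have hasc : ascSeq n P = List.ofFn (l ∘ e) := by
    simpa [List.map_ofFn, Function.comp_def] using hrep.ascSeq_eq hcount hsorted
  rw [fPS, fPA, hcard, hasc, hcod.fAS_ofFn]

end Encodes

lemma encodes_iff {n : ℕ} (hn : 1 ≤ n) {π : Equiv.Perm (Fin n)} {P : FinPartOrd.{0}} :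
    Encodes π P ↔ IsRPoset n P ∧ fPS P = oneLine π := by
  refine ⟨fun h => ⟨h.isRPoset hn, h.fPS_eq⟩, fun ⟨hP, hfPS⟩ => ?_⟩
  obtain ⟨σ, hσ⟩ := hP.exists_encodes
  rwa [← oneLine_injective (hσ.fPS_eq.symm.trans hfPS)]

end PosetDuality

open PosetDuality in
theorem mainTheorem3 (n : ℕ) (hn : 1 ≤ n) (π : Equiv.Perm (Fin n))
    (hπ : PosetDuality.AvoidsBarred π) :
    PosetDuality.IsDualAccordingTo n PosetDuality.fPS (PosetDuality.oneLine π)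
      (PosetDuality.oneLine (PosetDuality.compl (PosetDuality.rev π))⁻¹) := by
  refine ⟨?_, fun P Q hP hQ hPπ => ?_, fun P hP hPπ => ?_⟩
  · obtain ⟨P, hP⟩ := hπ.exists_encodes
    exact ⟨P, (encodes_iff hn).1 hP⟩
  · have hencP : Encodes π P := (encodes_iff hn).2 ⟨hP, hPπ⟩
    constructor
    · exact fun hQπ => hencP.nonempty_orderIso ((encodes_iff hn).2 ⟨hQ, hQπ⟩)
    · rintro ⟨φ⟩
      exact (hencP.congr φ).fPS_eq
  · have hencP : Encodes π P := (encodes_iff hn).2 ⟨hP, hPπ⟩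
    exact (encodes_iff hn).1 hencP.dual
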